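/- Let $\mathscr{P}_2(\mathbb{R})$ be the set of Borel probability measures on $\mathbb{R}$ with finite second moment, with the topology of the $2$-Wasserstein distance $W_2(\rho,\tau)=\bigl(\inf_\pi\int|x-y|^2\,d\pi(x,y)\bigr)^{1/2}$, where $\pi$ runs over the measures on $\mathbb{R}\times\mathbb{R}$ with marginals $\rho$ and $\tau$. Let $\sigma,\mu,\nu\in\mathscr{P}_2(\mathbb{R})$, and let $\sigma$ be absolutely continuous with respect to Lebesgue measure. Then for every $\rho\in\mathscr{P}_2(\mathbb{R})$ there is a unique ($\sigma$-a.e.) optimal transport map $T_\sigma^\rho\in L^2(\mathbb{R},\sigma)$, i.e. a minimizer of $\int|T(x)-x|^2\,d\sigma(x)$ among all maps $T$ with $T_\sharp\sigma=\rho$; write $F_\sigma(\rho)=T_\sigma^\rho$ (the LOT, in this case CDT, embedding). Let $\mathcal{H}$ be a convex set of monotonically increasing (not necessarily strictly increasing) functions $\mathbb{R}\to\mathbb{R}$, and for $\kappa\in\mathscr{P}_2(\mathbb{R})$ let $\mathcal{H}\star\kappa$ be the set of all measures in $\mathscr{P}_2(\mathbb{R})$ of the form $h_\sharp\kappa$ with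 $h\in\mathcal{H}$ (thus $\mathcal{H}\star\kappa=\{h_\sharp\kappa:h\in\mathcal{H}\}$ if $\mathcal{H}\subseteq L^2(\mathbb{R},\kappa)$). If $\mathcal{H}\star\mu$ is closed in $\mathscr{P}_2(\mathbb{R})$, $\mathcal{H}\star\nu$ is compact, and these two sets are disjoint, then $F_\sigma(\mathcal{H}\star\mu)$ and $F_\sigma(\mathcal{H}\star\nu)$ are linearly separable in $L^2(\mathbb{R},\sigma)$: there are $w\in L^2(\mathbb{R},\sigma)$, $w\neq0$, and $b\in\mathbb{R}$ such that $\langle w,f\rangle<b$ for all $f\in F_\sigma(\mathcal{H}\star\mu)$ and $\langle w,g\rangle>b$ for all $g\in F_\sigma(\mathcal{H}\star\nu)$. -/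

import Mathlib

open MeasureTheory
open scoped ENNReal

/-- `𝒫₂(ℝ)`: the Borel probability measures on `ℝ` with finite second moment. -/
structure P2 where
  toMeasure : Measure ℝ
  isProbabilityMeasure : IsProbabilityMeasure toMeasure
  memLp_id : MemLp (fun x : ℝ => x) 2 toMeasure

namespace P2

instance (ρ : P2) : IsProbabilityMeasure ρ.toMeasure := ρ.isProbabilityMeasure

/-- The couplings of `ρ` and `τ`: the measures on `ℝ × ℝ` with marginals `ρ` and `τ`. -/
def couplings (ρ τ : P2) : Set (Measure (ℝ × ℝ)) :=
  {π | π.map Prod.fst = ρ.toMeasure ∧ π.map Prod.snd = τ.toMeasure}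

/-- The 2-Wasserstein distance `W₂(ρ, τ) = (inf_π ∫ |x - y|² dπ(x, y))^{1/2}`. -/
noncomputable def W2 (ρ τ : P2) : ℝ≥0∞ :=
  (⨅ π ∈ couplings ρ τ, ∫⁻ p, ‖p.1 - p.2‖ₑ ^ 2 ∂π) ^ (1 / 2 : ℝ)

/-- The topology of the metric `W₂`: a set is open if it contains, with each of its points,
a `W₂`-ball of positive radius around that point. -/
instance : TopologicalSpace P2 where
  IsOpen U := ∀ ρ ∈ U, ∃ ε : ℝ≥0∞, 0 < ε ∧ ∀ τ : P2, W2 ρ τ < ε → τ ∈ U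
  isOpen_univ := fun _ _ => ⟨1, one_pos, fun _ _ => trivial⟩
  isOpen_inter := by
    rintro U V hU hV ρ ⟨hρU, hρV⟩
    obtain ⟨a, ha, hUa⟩ := hU ρ hρU
    obtain ⟨b, hb, hVb⟩ := hV ρ hρV
    exact ⟨min a b, lt_min ha hb, fun τ hτ =>
      ⟨hUa τ (hτ.trans_le (min_le_left _ _)), hVb τ (hτ.trans_le (min_le_right _ _))⟩⟩
  isOpen_sUnion := by
    rintro s hs ρ ⟨U, hUs, hρU⟩
    obtain ⟨ε, hε, h⟩ := hs U hUs ρ hρU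
    exact ⟨ε, hε, fun τ hτ => ⟨U, hUs, h τ hτ⟩⟩

/-- `T` is an optimal transport map from `σ` to `ρ` for the cost `|x - y|²`: it lies in `L²(σ)`,
pushes `σ` to `ρ`, and has the least cost among all maps that push `σ` to `ρ`. -/
def IsOptimalTransportMap (σ ρ : P2) (T : ℝ → ℝ) : Prop :=
  MemLp T 2 σ.toMeasure ∧ σ.toMeasure.map T = ρ.toMeasure ∧
    ∀ S : ℝ → ℝ, AEMeasurable S σ.toMeasure → σ.toMeasure.map S = ρ.toMeasure →
      ∫⁻ x, ‖T x - x‖ₑ ^ 2 ∂σ.toMeasure ≤ ∫⁻ x, ‖S x - x‖ₑ ^ 2 ∂σ.toMeasure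

open Classical in
/-- The linear optimal transport embedding `F_σ : 𝒫₂(ℝ) → L²(ℝ, σ)`, `ρ ↦ T_σ^ρ`. (The default
value `0` only occurs where no optimal transport map exists, so never for `σ ≪ volume`.) -/
noncomputable def LOT (σ ρ : P2) : Lp ℝ 2 σ.toMeasure :=
  if h : ∃ T : Lp ℝ 2 σ.toMeasure, IsOptimalTransportMap σ ρ T then h.choose else 0

/-- `ℋ ⋆ μ`: the measures in `𝒫₂(ℝ)` of the form `h_♯ μ` with `h ∈ ℋ`. For measurable `h`, the
measure `h_♯ μ` lies in `𝒫₂(ℝ)` if and only if `h ∈ L²(ℝ, μ)`. -/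
def orbit (H : Set (ℝ → ℝ)) (μ : P2) : Set P2 :=
  {ρ | ∃ h ∈ H, μ.toMeasure.map h = ρ.toMeasure}

end P2

/-- Two sets in a real inner product space are linearly separable if some hyperplane
`⟨w, x⟩ = b` has one of them strictly on one side and the other strictly on the other side. -/
def LinearlySeparable {V : Type*} [NormedAddCommGroup V] [InnerProductSpace ℝ V]
    (A B : Set V) : Prop :=
  ∃ (w : V) (b : ℝ), w ≠ 0 ∧ (∀ x ∈ A, inner ℝ w x < b) ∧ ∀ y ∈ B, b < inner ℝ w y

open Set

/-! On the line, monotonicity decides optimality. Hoeffding's formula writes the quadratic cost of a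
plan as an integral of quadrant masses, and a plan carried by a monotone curve minimizes all of
these masses at once (`lintegral_enorm_sub_sq_le_of_monotoneOn`). Quantile maps therefore give
optimal maps, and `ae_eq_of_integral_mul_le` makes them unique.

Hence every T_σ^ρ is increasing off a null set. Two such maps together form an optimal plan between
their images, so `LOT σ` is an isometry into L²(σ); and T_σ^{h_♯μ} = h ∘ T_σ^μ for increasing h. The
latter is linear in h, so the images of both orbits are convex; they are also closed, compact and
disjoint as required, and Hahn–Banach separates them. Since an orbit may be empty, w ≠ 0 also needs
the range of `LOT σ` to be proper. -/

/-! ### Hoeffding's formula and monotone plans -/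

/-- The square of a distance on the line as an area in the plane. -/
theorem enorm_sub_sq_eq_volume (x y : ℝ) :
    ‖x - y‖ₑ ^ 2 = volume {q : ℝ × ℝ | x ≤ min q.1 q.2 ∧ max q.1 q.2 < y} +
      volume {q : ℝ × ℝ | y ≤ min q.1 q.2 ∧ max q.1 q.2 < x} := by
  have key : ∀ a b : ℝ, {q : ℝ × ℝ | a ≤ min q.1 q.2 ∧ max q.1 q.2 < b} =
      Ico a b ×ˢ Ico a b := by
    intro a b
    ext q
    simp only [mem_ofPred_eq, mem_prod, mem_Ico, le_min_iff, max_lt_iff]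
    tauto
  rw [key, key, Measure.volume_eq_prod, Measure.prod_prod, Measure.prod_prod, Real.volume_Ico,
    Real.volume_Ico, ← pow_two, ← pow_two, Real.enorm_eq_ofReal_abs]
  rcases le_total x y with h | h
  · rw [abs_sub_comm, abs_of_nonneg (sub_nonneg.2 h), ENNReal.ofReal_of_nonpos (sub_nonpos.2 h)]
    simp
  · rw [abs_of_nonneg (sub_nonneg.2 h), ENNReal.ofReal_of_nonpos (sub_nonpos.2 h)]
    simp

/-- Hoeffding's formula for the quadratic transport cost of a plan on the line. -/
theorem lintegral_enorm_sub_sq_eq (π : Measure (ℝ × ℝ)) [SFinite π] :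
    ∫⁻ p, ‖p.1 - p.2‖ₑ ^ 2 ∂π = ∫⁻ q : ℝ × ℝ,
      (π (Iic (min q.1 q.2) ×ˢ Ioi (max q.1 q.2)) +
        π (Ioi (max q.1 q.2) ×ˢ Iic (min q.1 q.2))) := by
  have hA : MeasurableSet {r : (ℝ × ℝ) × (ℝ × ℝ) |
      r.1.1 ≤ min r.2.1 r.2.2 ∧ max r.2.1 r.2.2 < r.1.2} :=
    MeasurableSet.inter
      (measurableSet_le (f := fun r : (ℝ × ℝ) × (ℝ × ℝ) => r.1.1)
        (g := fun r => min r.2.1 r.2.2) (by fun_prop) (by fun_prop))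
      (measurableSet_lt (f := fun r : (ℝ × ℝ) × (ℝ × ℝ) => max r.2.1 r.2.2)
        (g := fun r => r.1.2) (by fun_prop) (by fun_prop))
  have hB : MeasurableSet {r : (ℝ × ℝ) × (ℝ × ℝ) |
      r.1.2 ≤ min r.2.1 r.2.2 ∧ max r.2.1 r.2.2 < r.1.1} :=
    MeasurableSet.inter
      (measurableSet_le (f := fun r : (ℝ × ℝ) × (ℝ × ℝ) => r.1.2)
        (g := fun r => min r.2.1 r.2.2) (by fun_prop) (by fun_prop))
      (measurableSet_lt (f := fun r : (ℝ × ℝ) × (ℝ × ℝ) => max r.2.1 r.2.2)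
        (g := fun r => r.1.1) (by fun_prop) (by fun_prop))
  -- Tonelli: the same planar area is integrated over the plan first or over q first.
  have e1 := Measure.prod_apply (μ := π) (ν := (volume : Measure (ℝ × ℝ))) hA
  have e2 := Measure.prod_apply (μ := π) (ν := (volume : Measure (ℝ × ℝ))) hB
  have e3 := Measure.prod_apply_symm (μ := π) (ν := (volume : Measure (ℝ × ℝ))) hA
  have e4 := Measure.prod_apply_symm (μ := π) (ν := (volume : Measure (ℝ × ℝ))) hB
  have l := congrArg₂ (· + ·) e1 e2
  rw [← lintegral_add_left (measurable_measure_prodMk_left hA)] at l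
  rw [lintegral_congr fun p : ℝ × ℝ => enorm_sub_sq_eq_volume p.1 p.2]
  refine l.symm.trans ?_
  rw [e3, e4, ← lintegral_add_left (measurable_measure_prodMk_right hA)]
  refine lintegral_congr fun q => ?_
  congr 2
  ext p
  simp [and_comm]

/-- Among the plans with given marginals, a plan carried by a monotone curve has the least
quadratic cost. -/
theorem lintegral_enorm_sub_sq_le_of_monotoneOn {σ : Measure ℝ} [IsFiniteMeasure σ]
    {T S : ℝ → ℝ} (hTm : AEMeasurable T σ) (hSm : AEMeasurable S σ) {s : Set ℝ}
    (hs : s ∈ ae σ) (hT : MonotoneOn T s) (hS : MonotoneOn S s)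
    (π : Measure (ℝ × ℝ)) (h1 : π.map Prod.fst = σ.map T) (h2 : π.map Prod.snd = σ.map S) :
    ∫⁻ x, ‖T x - S x‖ₑ ^ 2 ∂σ ≤ ∫⁻ p, ‖p.1 - p.2‖ₑ ^ 2 ∂π := by
  have hfin : IsFiniteMeasure π := by
    constructor
    have := congrArg (fun m : Measure ℝ => m univ) h1
    simp only [Measure.map_apply measurable_fst MeasurableSet.univ, preimage_univ] at this
    rw [this]
    exact measure_lt_top _ _
  -- Within `s`, sublevel sets of `U` and `V` are initial segments, hence nested: the set on the
  -- left is null, or `V ≤ b` implies `U ≤ a` almost everywhere. The right side is a lower bound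
  -- valid for any plan with these marginals.
  have nest : ∀ {U V : ℝ → ℝ} (_ : AEMeasurable U σ) (_ : AEMeasurable V σ)
      (_ : MonotoneOn U s) (_ : MonotoneOn V s) (a b : ℝ),
      σ {x | U x ≤ a ∧ b < V x} ≤ σ {x | U x ≤ a} - σ {x | V x ≤ b} := by
    intro U V hUm hVm hU hV a b
    by_cases h : ∃ x ∈ s, U x ≤ a ∧ b < V x
    · obtain ⟨x, hx, hxa, hxb⟩ := h
      have hsub : ∀ y ∈ s, V y ≤ b → U y ≤ a := by
        intro y hy hyb
        rcases le_total x y with hxy | hxy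
        · exact absurd (hV hx hy hxy) (by linarith)
        · exact (hU hy hx hxy).trans hxa
      have e : σ {x | U x ≤ a ∧ b < V x} = σ ({x | U x ≤ a} \ {x | V x ≤ b}) := by
        congr 1
        ext y
        simp
      have hle : {x | V x ≤ b} ≤ᵐ[σ] {x | U x ≤ a} := by
        filter_upwards [hs] with y hy hyb using hsub y hy hyb
      rw [e, measure_sdiff' _ (nullMeasurableSet_le hVm aemeasurable_const) (measure_ne_top _ _)]
      apply tsub_le_tsub_right
      rw [measure_congr (union_ae_eq_left_iff_ae_subset.2 hle)]
    · have : σ {x | U x ≤ a ∧ b < V x} = 0 := by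
        rw [measure_eq_zero_iff_ae_notMem]
        filter_upwards [hs] with y hy hyab using h ⟨y, hy, hyab⟩
      rw [this]
      exact zero_le
  have m1 : ∀ a, π (Prod.fst ⁻¹' Iic a) = σ {x | T x ≤ a} := fun a => by
    rw [← Measure.map_apply measurable_fst measurableSet_Iic, h1,
      Measure.map_apply_of_aemeasurable hTm measurableSet_Iic]
    rfl
  have m2 : ∀ a, π (Prod.snd ⁻¹' Iic a) = σ {x | S x ≤ a} := fun a => by
    rw [← Measure.map_apply measurable_snd measurableSet_Iic, h2,
      Measure.map_apply_of_aemeasurable hSm measurableSet_Iic]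
    rfl
  have hTS := hTm.prodMk hSm
  have e0 : ∫⁻ x, ‖T x - S x‖ₑ ^ 2 ∂σ = ∫⁻ p, ‖p.1 - p.2‖ₑ ^ 2 ∂(σ.map fun x => (T x, S x)) := by
    rw [lintegral_map' (by fun_prop) hTS]
  rw [e0, lintegral_enorm_sub_sq_eq, lintegral_enorm_sub_sq_eq]
  refine lintegral_mono fun q => add_le_add ?_ ?_
  · rw [Measure.map_apply_of_aemeasurable hTS (measurableSet_Iic.prod measurableSet_Ioi)]
    refine (nest hTm hSm hT hS _ _).trans ?_
    rw [← m1, ← m2]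
    refine le_measure_sdiff.trans (measure_mono ?_)
    rintro p ⟨hp, hp'⟩
    exact ⟨hp, mem_Ioi.2 (not_le.1 fun h => hp' h)⟩
  · rw [Measure.map_apply_of_aemeasurable hTS (measurableSet_Ioi.prod measurableSet_Iic)]
    refine (measure_mono ?_).trans ((nest hSm hTm hS hT (min q.1 q.2) (max q.1 q.2)).trans ?_)
    · rintro x ⟨hx, hx'⟩
      exact ⟨hx', hx⟩
    rw [← m1, ← m2]
    refine le_measure_sdiff.trans (measure_mono ?_)
    rintro p ⟨hp, hp'⟩
    exact ⟨mem_Ioi.2 (not_le.1 fun h => hp' h), hp⟩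

/-! ### Quantile maps -/

theorem continuous_cdf_of_nullSingletonClass (σ : Measure ℝ) [IsProbabilityMeasure σ]
    [NullSingletonClass σ] : Continuous (ProbabilityTheory.cdf σ) := by
  refine continuous_iff_continuousAt.2 fun x => ?_
  rw [(ProbabilityTheory.monotone_cdf σ).continuousAt_iff_leftLim_eq_rightLim,
    StieltjesFunction.rightLim_eq]
  have h := (ProbabilityTheory.cdf σ).measure_singleton x
  rw [ProbabilityTheory.measure_cdf, measure_singleton, eq_comm, ENNReal.ofReal_eq_zero] at h
  exact le_antisymm ((ProbabilityTheory.monotone_cdf σ).leftLim_le le_rfl) (by linarith)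

/-- The set where the distribution function of `σ` is at most `u` has measure `u`, if `σ` has no
atoms. -/
theorem measureReal_cdf_le (σ : Measure ℝ) [IsProbabilityMeasure σ] [NullSingletonClass σ] {u : ℝ}
    (h0 : 0 ≤ u) (h1 : u ≤ 1) :
    σ.real {x | ProbabilityTheory.cdf σ x ≤ u} = u := by
  have ivt : ∀ v : ℝ, 0 < v → v < 1 → ∃ y, ProbabilityTheory.cdf σ y = v := by
    intro v hv0 hv1
    obtain ⟨a, ha⟩ := ((ProbabilityTheory.tendsto_cdf_atBot σ).eventually_lt_const hv0).exists
    obtain ⟨b, hb⟩ := ((ProbabilityTheory.tendsto_cdf_atTop σ).eventually_const_lt hv1).exists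
    exact mem_range_of_exists_le_of_exists_ge (continuous_cdf_of_nullSingletonClass σ)
      ⟨a, ha.le⟩ ⟨b, hb.le⟩
  apply le_antisymm
  -- The distribution function may be flat at level u, so u is approached by attained levels v > u.
  · refine le_of_forall_gt_imp_ge_of_dense fun v hv => ?_
    rcases le_or_gt 1 v with hv1 | hv1
    · exact measureReal_le_one.trans hv1
    · obtain ⟨y, hy⟩ := ivt v (h0.trans_lt hv) hv1
      rw [← hy, ProbabilityTheory.cdf_eq_real]
      refine measureReal_mono fun x hx => mem_Iic.2 (le_of_not_gt fun hxy => ?_)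
      have := ProbabilityTheory.monotone_cdf σ hxy.le
      exact absurd (this.trans hx) (by linarith)
  · rcases h0.eq_or_lt with rfl | h0
    · exact measureReal_nonneg
    rcases h1.eq_or_lt with rfl | h1
    · have : {x | ProbabilityTheory.cdf σ x ≤ 1} = univ :=
        eq_univ_of_forall fun x => ProbabilityTheory.cdf_le_one σ x
      rw [this]
      simp
    · obtain ⟨y, hy⟩ := ivt u h0 h1
      conv_lhs => rw [← hy, ProbabilityTheory.cdf_eq_real]
      exact measureReal_mono fun x hx => (ProbabilityTheory.monotone_cdf σ hx).trans hy.le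

/-- Every probability measure on the line is the image of a given one without atoms under a map
that is monotone up to a null set. -/
theorem exists_monotoneOn_map_eq (σ ρ : Measure ℝ) [IsProbabilityMeasure σ]
    [IsProbabilityMeasure ρ] [NullSingletonClass σ] :
    ∃ T : ℝ → ℝ, AEMeasurable T σ ∧ (∃ s ∈ ae σ, MonotoneOn T s) ∧ σ.map T = ρ := by
  set F := ProbabilityTheory.cdf σ
  set G := ProbabilityTheory.cdf ρ
  have hF : Continuous F := continuous_cdf_of_nullSingletonClass σ
  -- Outside `s` the set defining the quantile below may be unbounded below or empty, and `sInf`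
  -- takes a junk value.
  set s : Set ℝ := {x | 0 < F x ∧ F x < 1}
  have hsm : MeasurableSet s := (hF.measurable measurableSet_Ioi).inter
    (hF.measurable measurableSet_Iio)
  have hs : s ∈ ae σ := by
    have a0 : ∀ᵐ x ∂σ, ¬ F x ≤ 0 := by
      rw [ae_iff]
      simpa [measureReal_eq_zero_iff] using measureReal_cdf_le σ le_rfl zero_le_one
    have a1 : ∀ᵐ x ∂σ, F x < 1 := by
      have hle : ∀ u < 1, 0 ≤ u → σ.real {x | F x < 1}ᶜ ≤ 1 - u := by
        intro u hu hu0
        have h := probReal_compl_eq_one_sub (μ := σ) (s := {x | F x ≤ u})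
          (hF.measurable measurableSet_Iic)
        rw [measureReal_cdf_le σ hu0 hu.le] at h
        rw [← h]
        exact measureReal_mono fun x hx hx' => hx (lt_of_le_of_lt hx' hu)
      have h0 : σ.real {x | F x < 1}ᶜ = 0 := by
        refine le_antisymm (le_of_forall_gt_imp_ge_of_dense fun e he => ?_) measureReal_nonneg
        rcases le_or_gt 1 e with h | h
        · exact measureReal_le_one.trans h
        · simpa using hle (1 - e) (by linarith) (by linarith)
      rwa [measureReal_eq_zero_iff] at h0
    filter_upwards [a0, a1] with x h0 h1 using ⟨not_le.1 h0, h1⟩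
  set T : ℝ → ℝ := fun x => sInf {y | F x ≤ G y}
  -- Right continuity of `G` makes the infimum attained, which gives this Galois connection.
  have gal : ∀ x ∈ s, ∀ y, T x ≤ y ↔ F x ≤ G y := by
    intro x hx y
    have hbdd : BddBelow {y | F x ≤ G y} := by
      obtain ⟨a, ha⟩ := ((ProbabilityTheory.tendsto_cdf_atBot ρ).eventually_lt_const hx.1).exists
      refine ⟨a, fun z hz => le_of_not_gt fun hza => ?_⟩
      exact absurd (hz : F x ≤ G z)
        (not_le.2 ((ProbabilityTheory.monotone_cdf ρ hza.le).trans_lt ha))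
    have hne : {y | F x ≤ G y}.Nonempty := by
      obtain ⟨b, hb⟩ := ((ProbabilityTheory.tendsto_cdf_atTop ρ).eventually_const_lt hx.2).exists
      exact ⟨b, hb.le⟩
    refine ⟨fun h => ?_, fun h => csInf_le hbdd h⟩
    have hr : Filter.Tendsto G (nhdsWithin y (Ioi y)) (nhds (G y)) :=
      ((ProbabilityTheory.cdf ρ).right_continuous y).mono_left (nhdsWithin_mono _ Ioi_subset_Ici_self)
    refine ge_of_tendsto hr ?_
    filter_upwards [self_mem_nhdsWithin] with z hz
    obtain ⟨w, hw, hwz⟩ := exists_lt_of_csInf_lt hne (h.trans_lt hz)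
    exact le_trans hw (ProbabilityTheory.monotone_cdf ρ hwz.le)
  have hT : MonotoneOn T s := fun x hx y hy hxy =>
    (gal x hx _).2 ((ProbabilityTheory.monotone_cdf σ hxy).trans ((gal y hy _).1 le_rfl))
  have hTm : AEMeasurable T σ := by
    have := aemeasurable_restrict_of_monotoneOn (μ := σ) hsm hT
    rwa [Measure.restrict_eq_self_of_ae_mem (s := s) (show ∀ᵐ x ∂σ, x ∈ s from hs)] at this
  refine ⟨T, hTm, ⟨s, hs, hT⟩, ?_⟩
  have := Measure.isProbabilityMeasure_map hTm
  refine Measure.ext_of_Iic _ _ fun y => ?_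
  rw [Measure.map_apply_of_aemeasurable hTm measurableSet_Iic, ← ProbabilityTheory.ofReal_cdf ρ y,
    ← measureReal_cdf_le σ (ProbabilityTheory.cdf_nonneg ρ y) (ProbabilityTheory.cdf_le_one ρ y),
    ofReal_measureReal]
  refine measure_congr ?_
  filter_upwards [hs] with x hx using propext (gal x hx y)

/-! ### Correlation and uniqueness -/

/-- Two functions that correlate equally with the identity, while one of them correlates at most as
much as the other with every increasing function, agree almost everywhere. -/
theorem ae_eq_of_integral_mul_le {σ : Measure ℝ} [IsFiniteMeasure σ] {T S : ℝ → ℝ}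
    (hid : MemLp (fun x : ℝ => x) 2 σ) (hT : MemLp T 2 σ) (hS : MemLp S 2 σ)
    (hle : ∀ g : ℝ → ℝ, Monotone g → MemLp g 2 σ → ∫ x, g x * T x ∂σ ≤ ∫ x, g x * S x ∂σ)
    (heq : ∫ x, x * T x ∂σ = ∫ x, x * S x ∂σ) : T =ᵐ[σ] S := by
  have hloc : LocallyIntegrable (T - S) σ :=
    ((hT.sub hS).integrable one_le_two).locallyIntegrable
  have key := ae_eq_zero_of_integral_contDiff_smul_eq_zero hloc fun g hg hgc => ?_
  · filter_upwards [key] with x hx using sub_eq_zero.1 hx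
  -- A test function g is K-Lipschitz, so Kx + g and Kx - g are both increasing. By `heq` the Kx
  -- terms cancel, leaving opposite inequalities for g.
  obtain ⟨K, hK⟩ := hg.lipschitzWith_of_hasCompactSupport hgc (by simp)
  have hgL : MemLp g 2 σ := hg.continuous.memLp_of_hasCompactSupport hgc
  have hdist : ∀ x y : ℝ, x ≤ y → |g x - g y| ≤ K * (y - x) := by
    intro x y hxy
    have := hK.dist_le_mul x y
    rwa [Real.dist_eq, Real.dist_eq, abs_sub_comm x, abs_of_nonneg (sub_nonneg.2 hxy)] at this
  have hmul : ∀ {f U : ℝ → ℝ}, MemLp f 2 σ → MemLp U 2 σ → Integrable (fun x => f x * U x) σ :=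
    fun hf hU => hf.integrable_mul hU
  have hKid : MemLp (fun x : ℝ => (K : ℝ) * x) 2 σ := hid.const_mul _
  have hp := hle (fun x => K * x + g x)
    (fun x y hxy => by dsimp only; linarith [(abs_le.1 (hdist x y hxy)).2]) (hKid.add hgL)
  have hm := hle (fun x => K * x - g x)
    (fun x y hxy => by dsimp only; linarith [(abs_le.1 (hdist x y hxy)).1]) (hKid.sub hgL)
  have i1 : ∀ {U : ℝ → ℝ}, MemLp U 2 σ → ∫ x, (K * x + g x) * U x ∂σ =
      K * ∫ x, x * U x ∂σ + ∫ x, g x * U x ∂σ := by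
    intro U hU
    rw [← integral_const_mul, ← integral_add ((hmul hid hU).const_mul (K : ℝ))
      (hmul hgL hU)]
    exact integral_congr_ae (Filter.Eventually.of_forall fun x => by simp; ring)
  have i2 : ∀ {U : ℝ → ℝ}, MemLp U 2 σ → ∫ x, (K * x - g x) * U x ∂σ =
      K * ∫ x, x * U x ∂σ - ∫ x, g x * U x ∂σ := by
    intro U hU
    rw [← integral_const_mul, ← integral_sub ((hmul hid hU).const_mul (K : ℝ))
      (hmul hgL hU)]
    exact integral_congr_ae (Filter.Eventually.of_forall fun x => by simp; ring)
  rw [i1 hT, i1 hS, heq] at hp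
  rw [i2 hT, i2 hS, heq] at hm
  have e : ∫ x, g x • (T - S) x ∂σ = ∫ x, g x * T x ∂σ - ∫ x, g x * S x ∂σ := by
    rw [← integral_sub (hmul hgL hT) (hmul hgL hS)]
    exact integral_congr_ae (Filter.Eventually.of_forall fun x => by simp; ring)
  rw [e]
  linarith

theorem lintegral_enorm_sq_eq {σ : Measure ℝ} {f : ℝ → ℝ} (hf : MemLp f 2 σ) :
    ∫⁻ x, ‖f x‖ₑ ^ 2 ∂σ = ENNReal.ofReal (∫ x, f x ^ 2 ∂σ) := by
  rw [ofReal_integral_eq_lintegral_ofReal hf.integrable_sq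
    (Filter.Eventually.of_forall fun x => sq_nonneg _)]
  refine lintegral_congr fun x => ?_
  rw [Real.enorm_eq_ofReal_abs, ← ENNReal.ofReal_pow (abs_nonneg _), sq_abs]

/-- For functions with the same law, a lower quadratic cost means a higher correlation. -/
theorem lintegral_enorm_sub_sq_le_iff {σ : Measure ℝ} {T S g : ℝ → ℝ} (hT : MemLp T 2 σ)
    (hS : MemLp S 2 σ) (hg : MemLp g 2 σ) (hmap : σ.map T = σ.map S) :
    ∫⁻ x, ‖T x - g x‖ₑ ^ 2 ∂σ ≤ ∫⁻ x, ‖S x - g x‖ₑ ^ 2 ∂σ ↔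
      ∫ x, g x * S x ∂σ ≤ ∫ x, g x * T x ∂σ := by
  -- Second moments depend only on the law, so only the cross terms differ.
  have hsq : ∫ x, T x ^ 2 ∂σ = ∫ x, S x ^ 2 ∂σ := by
    have h : ∫ y, y ^ 2 ∂(σ.map T) = ∫ y, y ^ 2 ∂(σ.map S) := by rw [hmap]
    rwa [integral_map hT.1.aemeasurable (by fun_prop),
      integral_map hS.1.aemeasurable (by fun_prop)] at h
  have ex : ∀ {U : ℝ → ℝ}, MemLp U 2 σ → ∫ x, (U x - g x) ^ 2 ∂σ =
      ∫ x, U x ^ 2 ∂σ - 2 * ∫ x, g x * U x ∂σ + ∫ x, g x ^ 2 ∂σ := by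
    intro U hU
    have hgU : Integrable (fun x => 2 * (g x * U x)) σ := (hg.integrable_mul hU).const_mul 2
    rw [← integral_const_mul, ← integral_sub hU.integrable_sq hgU,
      ← integral_add (f := fun x => U x ^ 2 - 2 * (g x * U x)) (hU.integrable_sq.sub hgU)
        hg.integrable_sq]
    exact integral_congr_ae (Filter.Eventually.of_forall fun x => by simp; ring)
  have a1 := lintegral_enorm_sq_eq (hT.sub hg)
  have a2 := lintegral_enorm_sq_eq (hS.sub hg)
  simp only [Pi.sub_apply] at a1 a2
  rw [a1, a2, ENNReal.ofReal_le_ofReal_iff (integral_nonneg fun x => sq_nonneg _), ex hT, ex hS,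
    hsq]
  constructor <;> intro h <;> linarith

/-! ### Optimal maps between measures in 𝒫₂(ℝ) -/

namespace P2

theorem memLp_of_map_eq {σ ρ : P2} {T : ℝ → ℝ} (hTm : AEMeasurable T σ.toMeasure)
    (hmap : σ.toMeasure.map T = ρ.toMeasure) : MemLp T 2 σ.toMeasure := by
  have h := ρ.memLp_id
  rw [← hmap] at h
  exact (memLp_map_measure_iff aestronglyMeasurable_id hTm).1 h

/-- The image of a measure in `𝒫₂(ℝ)` under a square-integrable map. -/
noncomputable def map (σ : P2) (T : ℝ → ℝ) (hT : MemLp T 2 σ.toMeasure) : P2 where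
  toMeasure := σ.toMeasure.map T
  isProbabilityMeasure := Measure.isProbabilityMeasure_map hT.1.aemeasurable
  memLp_id := (memLp_map_measure_iff aestronglyMeasurable_id hT.1.aemeasurable).2 hT

@[ext]
theorem ext {ρ τ : P2} (h : ρ.toMeasure = τ.toMeasure) : ρ = τ := by
  cases ρ
  cases τ
  congr

/-- A map that is monotone up to a null set is optimal. -/
theorem isOptimalTransportMap_of_monotoneOn {σ ρ : P2} {T : ℝ → ℝ}
    (hTm : AEMeasurable T σ.toMeasure) {s : Set ℝ} (hs : s ∈ ae σ.toMeasure)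
    (hT : MonotoneOn T s) (hmap : σ.toMeasure.map T = ρ.toMeasure) :
    IsOptimalTransportMap σ ρ T := by
  refine ⟨memLp_of_map_eq hTm hmap, hmap, fun S hSm hS => ?_⟩
  have hSid := hSm.prodMk (aemeasurable_id (μ := σ.toMeasure))
  have h := lintegral_enorm_sub_sq_le_of_monotoneOn hTm aemeasurable_id hs hT
    (monotone_id.monotoneOn s) (σ.toMeasure.map fun x => (S x, id x))
    (by
      rw [AEMeasurable.map_map_of_aemeasurable measurable_fst.aemeasurable hSid, hmap, ← hS]
      rfl)
    (by
      rw [AEMeasurable.map_map_of_aemeasurable measurable_snd.aemeasurable hSid]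
      rfl)
  rwa [lintegral_map' (by fun_prop) hSid] at h

/-- An optimal map agrees almost everywhere with a map that is monotone up to a null set. -/
theorem IsOptimalTransportMap.ae_eq_of_monotoneOn {σ ρ : P2} {S T : ℝ → ℝ}
    (hS : IsOptimalTransportMap σ ρ S) (hTm : AEMeasurable T σ.toMeasure) {s : Set ℝ}
    (hs : s ∈ ae σ.toMeasure) (hT : MonotoneOn T s)
    (hmap : σ.toMeasure.map T = ρ.toMeasure) : S =ᵐ[σ.toMeasure] T := by
  have hTL := memLp_of_map_eq hTm hmap
  have hle : ∀ g : ℝ → ℝ, Monotone g → MemLp g 2 σ.toMeasure →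
      ∫ x, g x * S x ∂σ.toMeasure ≤ ∫ x, g x * T x ∂σ.toMeasure := by
    intro g hg hgL
    rw [← lintegral_enorm_sub_sq_le_iff hTL hS.1 hgL (hmap.trans hS.2.1.symm)]
    have hSg := hS.1.1.aemeasurable.prodMk hgL.1.aemeasurable
    have h := lintegral_enorm_sub_sq_le_of_monotoneOn hTm hgL.1.aemeasurable hs hT
      (hg.monotoneOn s) (σ.toMeasure.map fun x => (S x, g x))
      (by
        rw [AEMeasurable.map_map_of_aemeasurable measurable_fst.aemeasurable hSg, hmap, ← hS.2.1]
        rfl)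
      (by
        rw [AEMeasurable.map_map_of_aemeasurable measurable_snd.aemeasurable hSg]
        rfl)
    rwa [lintegral_map' (by fun_prop) hSg] at h
  refine ae_eq_of_integral_mul_le σ.memLp_id hS.1 hTL hle (le_antisymm ?_ ?_)
  · exact hle _ monotone_id σ.memLp_id
  · rw [← lintegral_enorm_sub_sq_le_iff hS.1 hTL σ.memLp_id (hS.2.1.trans hmap.symm)]
    exact hS.2.2 T hTm hmap

theorem isOptimalTransportMap_congr {σ ρ : P2} {S T : ℝ → ℝ} (h : S =ᵐ[σ.toMeasure] T)
    (hT : IsOptimalTransportMap σ ρ T) : IsOptimalTransportMap σ ρ S := by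
  refine ⟨hT.1.ae_eq h.symm, (Measure.map_congr h).trans hT.2.1, fun U hU hU' => ?_⟩
  refine (lintegral_congr_ae ?_).trans_le (hT.2.2 U hU hU')
  filter_upwards [h] with x hx
  rw [hx]

end P2

/-! ### The embedding -/

namespace P2

theorem exists_monotoneOn_isOptimalTransportMap {σ : P2} (hσ : σ.toMeasure ≪ volume) (ρ : P2) :
    ∃ T : ℝ → ℝ, (∃ s ∈ ae σ.toMeasure, MonotoneOn T s) ∧ IsOptimalTransportMap σ ρ T := by
  have : NullSingletonClass σ.toMeasure := ⟨fun x => hσ (measure_singleton x)⟩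
  obtain ⟨T, hTm, ⟨s, hs, hT⟩, hmap⟩ := exists_monotoneOn_map_eq σ.toMeasure ρ.toMeasure
  exact ⟨T, ⟨s, hs, hT⟩, isOptimalTransportMap_of_monotoneOn hTm hs hT hmap⟩

theorem existsUnique_isOptimalTransportMap {σ : P2} (hσ : σ.toMeasure ≪ volume) (ρ : P2) :
    ∃! T : Lp ℝ 2 σ.toMeasure, IsOptimalTransportMap σ ρ T := by
  obtain ⟨T, ⟨s, hs, hT⟩, hopt⟩ := exists_monotoneOn_isOptimalTransportMap hσ ρ
  refine ⟨hopt.1.toLp T, isOptimalTransportMap_congr hopt.1.coeFn_toLp hopt, fun S hS => ?_⟩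
  exact Lp.ext ((hS.ae_eq_of_monotoneOn hopt.1.1.aemeasurable hs hT hopt.2.1).trans
    hopt.1.coeFn_toLp.symm)

theorem isOptimalTransportMap_LOT {σ : P2} (hσ : σ.toMeasure ≪ volume) (ρ : P2) :
    IsOptimalTransportMap σ ρ (LOT σ ρ) := by
  have h := (existsUnique_isOptimalTransportMap hσ ρ).exists
  rw [LOT, dif_pos h]
  exact h.choose_spec

theorem LOT_ae_eq_of_monotoneOn {σ ρ : P2} (hσ : σ.toMeasure ≪ volume) {T : ℝ → ℝ}
    (hTm : AEMeasurable T σ.toMeasure) {s : Set ℝ} (hs : s ∈ ae σ.toMeasure)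
    (hT : MonotoneOn T s) (hmap : σ.toMeasure.map T = ρ.toMeasure) :
    LOT σ ρ =ᵐ[σ.toMeasure] T :=
  (isOptimalTransportMap_LOT hσ ρ).ae_eq_of_monotoneOn hTm hs hT hmap

theorem exists_monotoneOn_LOT {σ : P2} (hσ : σ.toMeasure ≪ volume) (ρ : P2) :
    ∃ s ∈ ae σ.toMeasure, MonotoneOn (LOT σ ρ) s := by
  obtain ⟨T, ⟨s, hs, hT⟩, hopt⟩ := exists_monotoneOn_isOptimalTransportMap hσ ρ
  have h := LOT_ae_eq_of_monotoneOn hσ hopt.1.1.aemeasurable hs hT hopt.2.1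
  refine ⟨s ∩ {x | LOT σ ρ x = T x}, Filter.inter_mem hs h, fun x hx y hy hxy => ?_⟩
  rw [hx.2, hy.2]
  exact hT hx.1 hy.1 hxy

theorem LOT_injective {σ : P2} (hσ : σ.toMeasure ≪ volume) : Function.Injective (LOT σ) := by
  intro ρ τ h
  ext1
  rw [← (isOptimalTransportMap_LOT hσ ρ).2.1, h, (isOptimalTransportMap_LOT hσ τ).2.1]

theorem enorm_Lp_eq {σ : P2} (f : Lp ℝ 2 σ.toMeasure) :
    ‖f‖ₑ = (∫⁻ x, ‖f x‖ₑ ^ 2 ∂σ.toMeasure) ^ (1 / 2 : ℝ) := by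
  rw [Lp.enorm_def, eLpNorm_eq_lintegral_rpow_enorm_toReal (by norm_num) (by norm_num)]
  simp

/-- The embedding does not increase distances. -/
theorem enorm_LOT_sub_LOT_le {σ : P2} (hσ : σ.toMeasure ≪ volume) (ρ τ : P2) :
    ‖LOT σ ρ - LOT σ τ‖ₑ ≤ W2 ρ τ := by
  obtain ⟨s, hs, hρ⟩ := exists_monotoneOn_LOT hσ ρ
  obtain ⟨t, ht, hτ⟩ := exists_monotoneOn_LOT hσ τ
  have oρ := isOptimalTransportMap_LOT hσ ρ
  have oτ := isOptimalTransportMap_LOT hσ τ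
  rw [enorm_Lp_eq, W2]
  refine ENNReal.rpow_le_rpow (le_iInf₂ fun π hπ => ?_) (by norm_num)
  refine (lintegral_congr_ae ?_).trans_le (lintegral_enorm_sub_sq_le_of_monotoneOn
    oρ.1.1.aemeasurable oτ.1.1.aemeasurable (Filter.inter_mem hs ht)
    (hρ.mono inter_subset_left) (hτ.mono inter_subset_right) π
    (hπ.1.trans oρ.2.1.symm) (hπ.2.trans oτ.2.1.symm))
  filter_upwards [Lp.coeFn_sub (LOT σ ρ) (LOT σ τ)] with x hx
  rw [hx, Pi.sub_apply]

/-- The joint law of f and g is a coupling. Neither map need be optimal, so this applies to a mere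
L² limit of embedded measures. -/
theorem W2_le_enorm_sub {σ ρ τ : P2} (f g : Lp ℝ 2 σ.toMeasure)
    (hf : σ.toMeasure.map f = ρ.toMeasure) (hg : σ.toMeasure.map g = τ.toMeasure) :
    W2 ρ τ ≤ ‖f - g‖ₑ := by
  have hfm := (Lp.memLp f).1.aemeasurable
  have hgm := (Lp.memLp g).1.aemeasurable
  have hfg := hfm.prodMk hgm
  rw [enorm_Lp_eq, W2]
  refine ENNReal.rpow_le_rpow ((iInf₂_le (σ.toMeasure.map fun x => (f x, g x)) ?_).trans ?_)
    (by norm_num)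
  · constructor
    · rw [AEMeasurable.map_map_of_aemeasurable measurable_fst.aemeasurable hfg, ← hf]
      rfl
    · rw [AEMeasurable.map_map_of_aemeasurable measurable_snd.aemeasurable hfg, ← hg]
      rfl
  · rw [lintegral_map' (by fun_prop) hfg]
    refine (lintegral_congr_ae ?_).le
    filter_upwards [Lp.coeFn_sub f g] with x hx
    rw [hx, Pi.sub_apply]

theorem isOpen_iff {U : Set P2} :
    IsOpen U ↔ ∀ ρ ∈ U, ∃ ε : ℝ≥0∞, 0 < ε ∧ ∀ τ : P2, W2 ρ τ < ε → τ ∈ U :=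
  Iff.rfl

theorem continuous_LOT {σ : P2} (hσ : σ.toMeasure ≪ volume) : Continuous (LOT σ) := by
  refine continuous_def.2 fun U hU => isOpen_iff.2 fun ρ hρ => ?_
  obtain ⟨ε, hε, hU⟩ := EMetric.isOpen_iff.1 hU _ hρ
  refine ⟨ε, hε, fun τ hτ => hU ?_⟩
  rw [Metric.mem_eball, edist_comm, edist_eq_enorm_sub]
  exact (enorm_LOT_sub_LOT_le hσ ρ τ).trans_lt hτ

/-- The embedding maps closed sets to closed sets. -/
theorem isClosed_image_LOT {σ : P2} (hσ : σ.toMeasure ≪ volume) {A : Set P2} (hA : IsClosed A) :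
    IsClosed (LOT σ '' A) := by
  refine isClosed_of_closure_subset fun f hf => ?_
  rw [EMetric.mem_closure_iff] at hf
  have hmap : ∀ ρ, σ.toMeasure.map (LOT σ ρ) = ρ.toMeasure :=
    fun ρ => (isOptimalTransportMap_LOT hσ ρ).2.1
  -- The law of the limit f is the candidate preimage. If `LOT σ ρ` is close to f, then ρ is close
  -- to τ, so `LOT σ τ` is close to `LOT σ ρ` and thus to f; completeness of 𝒫₂(ℝ) is not needed.
  set τ : P2 := σ.map f (Lp.memLp f)
  have hτ : ∀ ρ, W2 τ ρ ≤ ‖f - LOT σ ρ‖ₑ := fun ρ => W2_le_enorm_sub f _ rfl (hmap ρ)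
  have hτA : τ ∈ A := by
    by_contra hn
    obtain ⟨ε, hε, h⟩ := isOpen_iff.1 hA.isOpen_compl τ hn
    obtain ⟨_, ⟨ρ, hρ, rfl⟩, hlt⟩ := hf ε hε
    rw [edist_eq_enorm_sub] at hlt
    exact h ρ ((hτ ρ).trans_lt hlt) hρ
  refine ⟨τ, hτA, ?_⟩
  rw [← edist_le_zero]
  refine le_of_forall_gt_imp_ge_of_dense fun ε hε => ?_
  obtain ⟨_, ⟨ρ, hρ, rfl⟩, hlt⟩ := hf (ε / 2) (ENNReal.half_pos hε.ne')
  calc edist (LOT σ τ) f ≤ edist (LOT σ τ) (LOT σ ρ) + edist (LOT σ ρ) f := edist_triangle _ _ _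
    _ ≤ ε / 2 + ε / 2 := by
      rw [edist_comm (LOT σ ρ) f]
      refine add_le_add ?_ hlt.le
      rw [edist_eq_enorm_sub] at hlt ⊢
      exact ((enorm_LOT_sub_LOT_le hσ τ ρ).trans (hτ ρ)).trans hlt.le
    _ = ε := ENNReal.add_halves ε

/-- The embedding intertwines the action of an increasing function with composition. -/
theorem LOT_ae_eq_comp {σ μ ρ : P2} (hσ : σ.toMeasure ≪ volume) {h : ℝ → ℝ} (hh : Monotone h)
    (hmap : μ.toMeasure.map h = ρ.toMeasure) :
    LOT σ ρ =ᵐ[σ.toMeasure] fun x => h (LOT σ μ x) := by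
  have o := isOptimalTransportMap_LOT hσ μ
  obtain ⟨s, hs, hT⟩ := exists_monotoneOn_LOT hσ μ
  refine LOT_ae_eq_of_monotoneOn hσ (hh.measurable.comp_aemeasurable o.1.1.aemeasurable) hs
    (fun x hx y hy hxy => hh (hT hx hy hxy)) ?_
  rw [← hmap, ← o.2.1, AEMeasurable.map_map_of_aemeasurable hh.measurable.aemeasurable
    o.1.1.aemeasurable]
  rfl

theorem convex_image_LOT_orbit {σ : P2} (hσ : σ.toMeasure ≪ volume) (μ : P2)
    {H : Set (ℝ → ℝ)} (hconv : Convex ℝ H) (hmono : ∀ h ∈ H, Monotone h) :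
    Convex ℝ (LOT σ '' orbit H μ) := by
  rintro _ ⟨ρ, ⟨g, hg, hgρ⟩, rfl⟩ _ ⟨τ, ⟨h, hh, hhτ⟩, rfl⟩ a b ha hb hab
  have hk := hconv hg hh ha hb hab
  have hkm := hmono _ hk
  have hgL := memLp_of_map_eq (hmono g hg).measurable.aemeasurable hgρ
  have hhL := memLp_of_map_eq (hmono h hh).measurable.aemeasurable hhτ
  have hkL : MemLp (a • g + b • h) 2 μ.toMeasure := (hgL.const_smul a).add (hhL.const_smul b)
  refine ⟨μ.map _ hkL, ⟨_, hk, rfl⟩, Lp.ext ?_⟩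
  filter_upwards [LOT_ae_eq_comp hσ (ρ := μ.map _ hkL) hkm rfl,
    LOT_ae_eq_comp hσ (hmono g hg) hgρ, LOT_ae_eq_comp hσ (hmono h hh) hhτ,
    Lp.coeFn_add (a • LOT σ ρ) (b • LOT σ τ), Lp.coeFn_smul a (LOT σ ρ),
    Lp.coeFn_smul b (LOT σ τ)] with x h1 h2 h3 h4 h5 h6
  rw [h1, h4, Pi.add_apply, Pi.add_apply, h5, h6]
  simp [h2, h3]

/-- The decreasing function `x ↦ -x` is not an optimal transport map. -/
theorem range_LOT_ne_univ {σ : P2} (hσ : σ.toMeasure ≪ volume) : range (LOT σ) ≠ univ := by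
  intro h
  have hid : MemLp (fun x : ℝ => -x) 2 σ.toMeasure := σ.memLp_id.neg
  obtain ⟨ρ, hρ⟩ := h.symm ▸ mem_univ (hid.toLp _)
  obtain ⟨s, hs, hT⟩ := exists_monotoneOn_LOT hσ ρ
  rw [hρ] at hT
  -- A set on which x ↦ -x is increasing has at most one point, hence is σ-null.
  have hsub : (s ∩ {x | hid.toLp _ x = -x}).Subsingleton := by
    have key : ∀ x ∈ s ∩ {x | hid.toLp _ x = -x}, ∀ y ∈ s ∩ {x | hid.toLp _ x = -x},
        x ≤ y → x = y := by
      intro x hx y hy hxy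
      have := hT hx.1 hy.1 hxy
      rw [hx.2, hy.2] at this
      linarith
    intro x hx y hy
    rcases le_total x y with hxy | hxy
    · exact key x hx y hy hxy
    · exact (key y hy x hx hxy).symm
  have h0 : σ.toMeasure (s ∩ {x | hid.toLp _ x = -x}) = 0 := hσ (hsub.measure_zero _)
  have h1 : s ∩ {x | hid.toLp _ x = -x} ∈ ae σ.toMeasure := Filter.inter_mem hs hid.coeFn_toLp
  rw [mem_ae_iff_prob_eq_one₀ (NullMeasurableSet.of_null h0), h0] at h1
  exact zero_ne_one h1

end P2

/-! ### Separation in Hilbert space -/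

/-- A closed convex set and a compact convex set that are disjoint are linearly separable in a
Hilbert space, provided that the first one is not the whole space. -/
theorem LinearlySeparable.of_isClosed_of_isCompact {V : Type*} [NormedAddCommGroup V]
    [InnerProductSpace ℝ V] [CompleteSpace V] {A B : Set V} (hA : Convex ℝ A) (hA' : IsClosed A)
    (hne : A ≠ univ) (hB : Convex ℝ B) (hB' : IsCompact B) (hAB : Disjoint A B)
    (hV : Nontrivial V) : LinearlySeparable A B := by
  have sep : ∀ B' : Set V, Convex ℝ B' → IsCompact B' → Disjoint A B' → A.Nonempty →
      B'.Nonempty → LinearlySeparable A B' := by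
    intro B' hB hB' hAB ⟨x, hx⟩ ⟨y, hy⟩
    obtain ⟨f, u, v, hu, huv, hv⟩ := geometric_hahn_banach_closed_compact hA hA' hB hB' hAB
    have hw : ∀ z, inner ℝ ((InnerProductSpace.toDual ℝ V).symm f) z = f z := fun z =>
      InnerProductSpace.toDual_symm_apply
    refine ⟨(InnerProductSpace.toDual ℝ V).symm f, u, fun h0 => ?_, fun z hz => ?_, fun z hz => ?_⟩
    · have h1 := hw x
      have h2 := hw y
      rw [h0, inner_zero_left] at h1 h2
      linarith [hu x hx, hv y hy]
    · rw [hw]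
      exact hu z hz
    · rw [hw]
      exact huv.trans (hv z hz)
  rcases A.eq_empty_or_nonempty with rfl | hAn
  · obtain ⟨w, hw⟩ := exists_ne (0 : V)
    obtain ⟨m, hm⟩ := (hB'.image (f := fun z => inner ℝ w z) (by fun_prop)).bddBelow
    refine ⟨w, m - 1, hw, fun x hx => hx.elim, fun y hy => ?_⟩
    linarith [hm (mem_image_of_mem _ hy)]
  rcases B.eq_empty_or_nonempty with rfl | hBn
  -- With B empty, any point outside A serves in its place.
  · obtain ⟨y, hy⟩ := (ne_univ_iff_exists_notMem A).1 hne
    obtain ⟨w, b, hw, h, -⟩ := sep {y} (convex_singleton y) isCompact_singleton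
      (disjoint_singleton_right.2 hy) hAn (singleton_nonempty y)
    exact ⟨w, b, hw, h, fun z hz => hz.elim⟩
  · exact sep B hB hB' hAB hAn hBn

theorem mainTheorem12 (σ μ ν : P2) (hσ : σ.toMeasure ≪ volume)
    (H : Set (ℝ → ℝ)) (hconv : Convex ℝ H) (hmono : ∀ h ∈ H, Monotone h)
    (hclosed : IsClosed (P2.orbit H μ)) (hcompact : IsCompact (P2.orbit H ν))
    (hdisj : Disjoint (P2.orbit H μ) (P2.orbit H ν)) :
    (∀ ρ : P2, ∃! T : Lp ℝ 2 σ.toMeasure, P2.IsOptimalTransportMap σ ρ T) ∧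
      LinearlySeparable (P2.LOT σ '' P2.orbit H μ) (P2.LOT σ '' P2.orbit H ν) := by
  have hne := P2.range_LOT_ne_univ hσ
  refine ⟨P2.existsUnique_isOptimalTransportMap hσ, .of_isClosed_of_isCompact
    (P2.convex_image_LOT_orbit hσ μ hconv hmono) (P2.isClosed_image_LOT hσ hclosed) ?_
    (P2.convex_image_LOT_orbit hσ ν hconv hmono) (hcompact.image (P2.continuous_LOT hσ))
    ((disjoint_image_iff (P2.LOT_injective hσ)).2 hdisj) ?_⟩
  · exact fun h => hne (univ_subset_iff.1 (h.symm.subset.trans (image_subset_range _ _)))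
  · obtain ⟨y, hy⟩ := (ne_univ_iff_exists_notMem _).1 hne
    exact ⟨y, P2.LOT σ μ, fun h => hy ⟨μ, h.symm⟩⟩
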